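/- Let $K$ be an infinite field, let $E = K((X,Y)) = \operatorname{Quot}(K[[X,Y]])$, and let $v$ be the discrete valuation of $E$ extending the order function of the maximal ideal $\langle X,Y\rangle$ of $K[[X,Y]]$. Let $I$ be a finite set and let $c_i \in K$ ($i \in I$) be pairwise distinct; put $z_i = \frac{Y}{X - c_iY} \in E$. For each $J \subseteq I$ let $D_J$ be the completion with respect to $v$ of the subring $K[z_k \mid k \in J][X,Y]$ of $E$; all these rings, and $E$, are viewed as subrings of the completion $\hat E$ of $E$ with respect to $v$ (so $D_J$ is the closure of $K[z_k \mid k\in J][X,Y]$ in $\hat E$). For each $i \in I$ let $Q_i = E\cdot D_{I\smallsetminus\{i\}}$ be the subring of $\hat E$ generated by $E$ and $D_{I\smallsetminus\{i\}}$. Fix $J \subseteq I$ and $j \in J$, and put $t = X - c_jY$. Let $K[[t]] \subseteq K[[X,Y]]$ be the ring of power series in $t$ over $K$ and $K((t)) \subseteq E$ its field of fractions. Then: (a) For each $0 \neq g \in D_J$, $D_J[t^{-1}] = K((t))[z_k \mid k \in J] + g\,D_J[t^{-1}]$. (b) For each $f \in D_J$ there exist $p \in K[[t]][z_j]$ and $u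 \in D_J^\times$ such that $f = pu$. (c) The ring $Q_j$ is a field. -/

import Mathlib

open scoped WithZero Pointwise

noncomputable section

namespace AnalyticRings

/-- The multiplicative form `f ↦ exp (-ord f)` (and `0 ↦ 0`) of the order function of the maximal
ideal `⟨X, Y⟩` of `K[[X, Y]]`; the order of `f ≠ 0` is the least total degree of a monomial that
occurs in `f`. -/
def orderValuation (K : Type*) [Field K] : Valuation (MvPowerSeries (Fin 2) K) ℤᵐ⁰ where
  toFun f := open Classical in if f = 0 then 0 else WithZero.exp (-(f.order.toNat : ℤ))
  map_zero' := by simp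
  map_one' := by simp [MvPowerSeries.order]
  map_mul' f g := by
    by_cases hf : f = 0
    · simp [hf]
    by_cases hg : g = 0
    · simp [hg]
    have hf' : f.order ≠ ⊤ := by simpa using hf
    have hg' : g.order ≠ ⊤ := by simpa using hg
    simp only [hf, hg, mul_eq_zero, or_self, if_false]
    rw [← WithZero.exp_add, MvPowerSeries.order_mul, ENat.toNat_add hf' hg']
    push_cast
    ring_nf
  map_add_le_max' f g := by
    by_cases hf : f = 0
    · rw [hf, zero_add]; exact le_max_right _ _
    by_cases hg : g = 0
    · rw [hg, add_zero]; exact le_max_left _ _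
    by_cases hfg : f + g = 0
    · simp [hfg]
    have hf' : f.order ≠ ⊤ := by simpa using hf
    have hg' : g.order ≠ ⊤ := by simpa using hg
    have hfg' : (f + g).order ≠ ⊤ := by simpa using hfg
    have h := MvPowerSeries.min_order_le_add (f := f) (g := g)
    simp only [hf, hg, hfg, if_false, le_max_iff, WithZero.exp_le_exp, neg_le_neg_iff,
      Nat.cast_le]
    rcases min_le_iff.1 h with h | h
    · exact Or.inl (ENat.toNat_le_toNat h hfg')
    · exact Or.inr (ENat.toNat_le_toNat h hfg')

/-- The field `E = K((X, Y)) = Quot(K[[X, Y]])`. -/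
abbrev E (K : Type*) [Field K] : Type _ := FractionRing (MvPowerSeries (Fin 2) K)

/-- The discrete valuation `v` of `E` that extends the order function. -/
def v (K : Type*) [Field K] : Valuation (E K) ℤᵐ⁰ :=
  (orderValuation K).extendToLocalization (S := nonZeroDivisors (MvPowerSeries (Fin 2) K))
    (fun f hf h => nonZeroDivisors.ne_zero hf (by
      by_contra h0
      simp [Valuation.mem_supp_iff, orderValuation, h0] at h)) (E K)

/-- The completion of the field `E` with respect to `v`. -/
abbrev Ehat (K : Type*) [Field K] : Type _ := (v K).Completion

/-- The canonical embedding of `E` into its completion. -/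
def incl (K : Type*) [Field K] : E K →+* Ehat K :=
  (UniformSpace.Completion.coeRingHom (α := WithVal (v K))).comp
    (WithVal.equiv (v K)).symm.toRingHom

section

variable {K : Type*} [Field K] {ι : Type*} (c : ι → K)

/-- The power series `X - c_i Y` in `K[[X, Y]]`. -/
def tSeries (i : ι) : MvPowerSeries (Fin 2) K :=
  MvPowerSeries.X 0 - MvPowerSeries.C (c i) * MvPowerSeries.X 1

theorem hasSubst_tSeries (i : ι) : PowerSeries.HasSubst (tSeries c i) :=
  PowerSeries.HasSubst.of_constantCoeff_zero (by simp [tSeries])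

/-- The element `t = X - c_i Y` of `E`. -/
def t (i : ι) : E K := algebraMap _ (E K) (tSeries c i)

/-- The element `z_i = Y / (X - c_i Y)` of `E`. -/
def z (i : ι) : E K := algebraMap (MvPowerSeries (Fin 2) K) (E K) (MvPowerSeries.X 1) / t c i

/-- The subring `K[z_j | j ∈ J][X, Y]` of `E`. -/
def polyRing (J : Set ι) : Subalgebra K (E K) :=
  Algebra.adjoin K (z c '' J ∪
    {algebraMap (MvPowerSeries (Fin 2) K) (E K) (MvPowerSeries.X 0),
      algebraMap (MvPowerSeries (Fin 2) K) (E K) (MvPowerSeries.X 1)})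

/-- The ring `D_J`: the completion of `K[z_j | j ∈ J][X, Y]` with respect to `v`, realized as
the closure of this ring in the completion of `E`. -/
def D (J : Set ι) : Subring (Ehat K) :=
  ((polyRing c J).toSubring.map (incl K)).topologicalClosure

/-- The ring `D_J[t⁻¹]`, where `t = X - c_j Y`. -/
def DInv (J : Set ι) (j : ι) : Subalgebra (D c J) (Ehat K) :=
  Algebra.adjoin (D c J) {(incl K (t c j))⁻¹}

/-- The ring `K[[t]] ⊆ K[[X, Y]] ⊆ E` of the power series in `t = X - c_j Y`. -/
def powerSeriesRing (j : ι) : Subring (E K) :=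
  ((algebraMap (MvPowerSeries (Fin 2) K) (E K)).comp
    (PowerSeries.substAlgHom (R := K) (hasSubst_tSeries c j)).toRingHom).range

/-- The field `K((t)) = Quot(K[[t]]) ⊆ E`, where `t = X - c_j Y`. -/
def laurentField (j : ι) : Subfield (E K) :=
  Subfield.closure (powerSeriesRing c j : Set (E K))

/-- The ring `Q_j = E · D_{I ∖ {j}}`: the subring generated by `E` and `D_{I ∖ {j}}`. -/
def Q (j : ι) : Subring (Ehat K) := (incl K).range ⊔ D c {j}ᶜ

end

end AnalyticRings

end

noncomputable section

namespace AnalyticRings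

open Polynomial

/-! Write `R_J = K[z_k | k ∈ J]`. Since `X = t(1 + c_j z_j)` and `Y = t z_j`, elements of `D_J`
behave like power series in `t` with coefficients in `R_J`. Nonzero elements of `R_J` have value 1,
so these coefficients are well determined (`v_eq_one_of_mem_zRing`, `exists_eq_add_t_mul`). Moreover
`z_k = z_j / (1 + (c_j - c_k) z_j)`, so `R_J` is a localization of `K[z_j]`, and modulo a nonzero
element every residue class is represented by a polynomial in `z_j` of bounded degree
(`exists_division_zRing`).

Dividing coefficient by coefficient gives a Weierstrass division theorem: the remainders have
bounded degree in `z_j`, hence sum to an element of `K[[t]][z_j]` (`exists_weierstrass_division`).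
Division gives (a) once powers of `t` are inverted, and gives the preparation theorem (b). For (c),
a common denominator moves an element of `Q_j` into `D_{I∖{j}}`, where it is a product of an element
of `E` and a unit. -/

/-- The extension of `v` to the completion. -/
def vHat (K : Type*) [Field K] : Valuation (Ehat K) ℤᵐ⁰ := Valued.v

/-! ### The order valuation and the value of `t` -/

section
variable {K : Type*} [Field K]

theorem vHat_incl (e : E K) : vHat K (incl K e) = v K e :=
  Valued.valuedCompletion_apply (K := WithVal (v K)) _

theorem v_algebraMap (f : MvPowerSeries (Fin 2) K) :
    v K (algebraMap _ (E K) f) = orderValuation K f :=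
  Valuation.extendToLocalization_apply_map_apply _ _ _ _

theorem orderValuation_le_exp_iff (f : MvPowerSeries (Fin 2) K) (n : ℕ) :
    orderValuation K f ≤ WithZero.exp (-(n : ℤ)) ↔ (n : ℕ∞) ≤ f.order := by
  by_cases hf : f = 0
  · simp [hf]
  · have hf' : f.order ≠ ⊤ := by simpa using hf
    obtain ⟨m, hm⟩ := ENat.ne_top_iff_exists.1 hf'
    have : orderValuation K f = WithZero.exp (-(m : ℤ)) := by simp [orderValuation, hf, ← hm]
    rw [this, WithZero.exp_le_exp, ← hm]
    simp

theorem orderValuation_eq_exp {f : MvPowerSeries (Fin 2) K} {n : ℕ} (h : f.order = n) :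
    orderValuation K f = WithZero.exp (-(n : ℤ)) := by
  have hf : f ≠ 0 := by rintro rfl; simp at h
  simp [orderValuation, hf, h]

theorem orderValuation_le_one (f : MvPowerSeries (Fin 2) K) : orderValuation K f ≤ 1 := by
  simpa using (orderValuation_le_exp_iff f 0).2 (by simp)

end

section
variable {K : Type*} [Field K] {ι : Type*} (c : ι → K)

theorem order_tSeries (i : ι) : (tSeries c i).order = (1 : ℕ) := by
  classical
  rw [MvPowerSeries.order_eq_nat]
  refine ⟨⟨Finsupp.single 0 1, ?_, by simp⟩, fun d hd => ?_⟩
  · simp [tSeries, MvPowerSeries.coeff_X, Finsupp.single_left_inj, MvPowerSeries.coeff_C_mul]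
  · have : d = 0 := (Finsupp.degree_eq_zero_iff d).1 (Nat.lt_one_iff.1 (by exact_mod_cast hd))
    subst this
    simp [tSeries]

theorem v_t (i : ι) : v K (t c i) = WithZero.exp (-1) := by
  rw [t, v_algebraMap, orderValuation_eq_exp (order_tSeries c i)]; simp

theorem t_ne_zero (i : ι) : t c i ≠ 0 := by
  intro h
  have := v_t c i
  rw [h, map_zero] at this
  exact WithZero.exp_ne_zero this.symm

theorem vHat_t_pow (i : ι) (n : ℕ) :
    vHat K (incl K (t c i) ^ n) = WithZero.exp (-(n : ℤ)) := by
  rw [map_pow, vHat_incl, v_t, ← WithZero.exp_nsmul]; simp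

theorem exists_exp_lt {γ : ℤᵐ⁰} (hγ : γ ≠ 0) : ∃ n : ℕ, WithZero.exp (-(n : ℤ)) < γ := by
  obtain ⟨a, rfl⟩ : ∃ a : ℤ, γ = WithZero.exp a :=
    ⟨WithZero.log γ, (WithZero.exp_log hγ).symm⟩
  refine ⟨(1 - a).toNat, ?_⟩
  rw [WithZero.exp_lt_exp]
  omega

end

/-! ### The topology of the completion -/

section
variable {K : Type*} [Field K]

theorem vHat_mem_closure_iff {S : Set (Ehat K)} {x : Ehat K} :
    x ∈ closure S ↔ ∀ n : ℕ, ∃ y ∈ S, vHat K (x - y) ≤ WithZero.exp (-(n : ℤ)) := by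
  rw [mem_closure_iff_nhds]
  constructor
  · intro h n
    -- Basic neighbourhoods are indexed by attained values, so the radius is realized as the value
    -- of a power of a uniformizer, here `X`.
    let a : Ehat K := incl K (t (fun _ : Unit => (0 : K)) ()) ^ n
    have ha : vHat K a = WithZero.exp (-(n : ℤ)) := vHat_t_pow _ _ n
    have ha0 : (Valued.v : Valuation (Ehat K) ℤᵐ⁰).restrict a ≠ 0 := by
      have : vHat K a ≠ 0 := by rw [ha]; exact WithZero.exp_ne_zero
      simpa [vHat] using this
    obtain ⟨y, hy, hyS⟩ := h _ (Valued.mem_nhds.2 ⟨Units.mk0 _ ha0, Set.Subset.rfl⟩)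
    refine ⟨y, hyS, ?_⟩
    have := (Valued.v (R := Ehat K)).restrict_lt_iff.mp hy
    rw [← ha, Valuation.map_sub_swap]
    exact this.le
  · intro h s hs
    obtain ⟨γ, hγ⟩ := (Valued.mem_nhds (R := Ehat K)).1 hs
    have h0 : MonoidWithZeroHom.ValueGroup₀.embedding γ.1 ≠ 0 := by
      simp
    obtain ⟨n, hn⟩ := exists_exp_lt h0
    obtain ⟨y, hy, hyn⟩ := h n
    refine ⟨y, hγ ?_, hy⟩
    simp only [Set.mem_ofPred_eq]
    rw [Valuation.restrict_lt_iff_lt_embedding, Valuation.map_sub_swap]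
    exact hyn.trans_lt hn

/-- Multiplication by `a` shifts values by a fixed amount. This allows membership of a quotient by
`a` to be tested before dividing. -/
theorem mem_closure_of_vHat_mul_le {S : Set (Ehat K)} {x a : Ehat K} (ha : a ≠ 0)
    (h : ∀ n : ℕ, ∃ y ∈ S, vHat K (a * (x - y)) ≤ WithZero.exp (-(n : ℤ))) :
    x ∈ closure S := by
  rw [vHat_mem_closure_iff]
  intro n
  obtain ⟨m, hm⟩ := exists_exp_lt (γ := vHat K a) (by simpa using ha)
  obtain ⟨y, hy, hyn⟩ := h (n + m)
  refine ⟨y, hy, ?_⟩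
  rw [map_mul] at hyn
  have h1 : WithZero.exp (-(m : ℤ)) * vHat K (x - y) ≤
      WithZero.exp (-(m : ℤ)) * WithZero.exp (-(n : ℤ)) := by
    rw [← WithZero.exp_add]
    refine (mul_le_mul_left hm.le _).trans (hyn.trans (le_of_eq ?_))
    push_cast
    ring_nf
  exact (mul_le_mul_iff_right₀ (WithZero.exp_pos)).1 h1

theorem eq_zero_of_vHat_le {x : Ehat K}
    (h : ∀ n : ℕ, vHat K x ≤ WithZero.exp (-(n : ℤ))) : x = 0 := by
  by_contra hx
  obtain ⟨m, hm⟩ := exists_exp_lt (γ := vHat K x) (by simpa using hx)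
  exact absurd (h m) (not_le.2 hm)

end

/-! ### The ring `R_J` and reduction modulo `t` -/

section
variable {K : Type*} [Field K] {ι : Type*} (c : ι → K)

theorem algebraMap_C (a : K) :
    algebraMap (MvPowerSeries (Fin 2) K) (E K) (MvPowerSeries.C a) = algebraMap K (E K) a :=
  (IsScalarTower.algebraMap_apply K (MvPowerSeries (Fin 2) K) (E K) a).symm

theorem z_mul_t (i : ι) :
    z c i * t c i = algebraMap (MvPowerSeries (Fin 2) K) (E K) (MvPowerSeries.X 1) :=
  div_mul_cancel₀ _ (t_ne_zero c i)

theorem algebraMap_X_zero (i : ι) :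
    algebraMap (MvPowerSeries (Fin 2) K) (E K) (MvPowerSeries.X 0) =
      t c i * (1 + algebraMap K (E K) (c i) * z c i) := by
  have : t c i = algebraMap (MvPowerSeries (Fin 2) K) (E K) (MvPowerSeries.X 0) -
      algebraMap K (E K) (c i) * (z c i * t c i) := by
    rw [z_mul_t]
    simp [t, tSeries, algebraMap_C]
  linear_combination -this

/-- The ring `R_J = K[z_k | k ∈ J]`. -/
def zRing (J : Set ι) : Subalgebra K (E K) := Algebra.adjoin K (z c '' J)

theorem z_mem_zRing {J : Set ι} {k : ι} (hk : k ∈ J) : z c k ∈ zRing c J :=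
  Algebra.subset_adjoin ⟨k, hk, rfl⟩

theorem zRing_le_polyRing (J : Set ι) : zRing c J ≤ polyRing c J :=
  Algebra.adjoin_mono Set.subset_union_left

theorem t_mem_polyRing (J : Set ι) (i : ι) : t c i ∈ polyRing c J := by
  have hX : algebraMap (MvPowerSeries (Fin 2) K) (E K) (MvPowerSeries.X 0) ∈ polyRing c J :=
    Algebra.subset_adjoin (by simp)
  have hY : algebraMap (MvPowerSeries (Fin 2) K) (E K) (MvPowerSeries.X 1) ∈ polyRing c J :=
    Algebra.subset_adjoin (by simp)
  have : t c i = algebraMap (MvPowerSeries (Fin 2) K) (E K) (MvPowerSeries.X 0) -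
      algebraMap K (E K) (c i) *
        algebraMap (MvPowerSeries (Fin 2) K) (E K) (MvPowerSeries.X 1) := by
    simp [t, tSeries, algebraMap_C]
  rw [this]
  exact sub_mem hX (mul_mem (Subalgebra.algebraMap_mem _ _) hY)

/-- `X` and `Y` are multiples of `t` because `j ∈ J`, so only the generators `z_k` contribute to the
constant term. -/
theorem exists_eq_add_t_mul_of_mem_polyRing {J : Set ι} {j : ι} (hj : j ∈ J) {y : E K}
    (hy : y ∈ polyRing c J) :
    ∃ r ∈ zRing c J, ∃ y' ∈ polyRing c J, y = r + t c j * y' := by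
  induction hy using Algebra.adjoin_induction with
  | mem x hx =>
    rcases hx with hx | rfl | rfl
    · exact ⟨x, Algebra.subset_adjoin hx, 0, zero_mem _, by simp⟩
    · exact ⟨0, zero_mem _, _, add_mem (one_mem _) (mul_mem (Subalgebra.algebraMap_mem _ (c j))
        (zRing_le_polyRing c J (z_mem_zRing c hj))), by rw [zero_add, ← algebraMap_X_zero]⟩
    · exact ⟨0, zero_mem _, _, zRing_le_polyRing c J (z_mem_zRing c hj), by
        rw [zero_add, mul_comm, z_mul_t]⟩
  | algebraMap r => exact ⟨_, Subalgebra.algebraMap_mem _ r, 0, zero_mem _, by simp⟩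
  | add x y _ _ hx hy =>
    obtain ⟨r, hr, x', hx', rfl⟩ := hx
    obtain ⟨q, hq, y', hy', rfl⟩ := hy
    exact ⟨_, add_mem hr hq, _, add_mem hx' hy', by ring⟩
  | mul x y _ _ hx hy =>
    obtain ⟨r, hr, x', hx', rfl⟩ := hx
    obtain ⟨q, hq, y', hy', rfl⟩ := hy
    have hr' := zRing_le_polyRing c J hr
    have hq' := zRing_le_polyRing c J hq
    exact ⟨_, mul_mem hr hq, r * y' + x' * q + t c j * (x' * y'),
      add_mem (add_mem (mul_mem hr' hy') (mul_mem hx' hq'))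
        (mul_mem (t_mem_polyRing c J j) (mul_mem hx' hy')), by ring⟩

/-! ### Polynomials in `z_j` have value 1 -/

/-- Evaluation of polynomials at `z_j`. -/
def evalZ (j : ι) : K[X] →ₐ[K] E K := aeval (z c j)

/-- The homogenization of a polynomial in the coordinates `Y` and `X - c_j Y`. -/
def homogenization (j : ι) (P : K[X]) : MvPolynomial (Fin 2) K :=
  ∑ i ∈ Finset.range (P.natDegree + 1), MvPolynomial.C (P.coeff i) * (MvPolynomial.X 1 ^ i *
    (MvPolynomial.X 0 - MvPolynomial.C (c j) * MvPolynomial.X 1) ^ (P.natDegree - i))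

theorem isHomogeneous_homogenization (j : ι) (P : K[X]) :
    (homogenization c j P).IsHomogeneous P.natDegree := by
  refine MvPolynomial.IsHomogeneous.sum _ _ _ fun i hi => ?_
  have h : (MvPolynomial.X 0 - MvPolynomial.C (c j) * MvPolynomial.X 1 :
      MvPolynomial (Fin 2) K).IsHomogeneous 1 :=
    (MvPolynomial.isHomogeneous_X _ _).sub ((MvPolynomial.isHomogeneous_X _ _).C_mul _)
  have h2 := ((MvPolynomial.isHomogeneous_X_pow (R := K) (1 : Fin 2) i).mul
    (h.pow (P.natDegree - i))).C_mul (P.coeff i)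
  have hi' : i ≤ P.natDegree := by simpa [Nat.lt_succ_iff] using hi
  convert h2 using 1
  omega

/-- The substitution is chosen so that `X - c_j Y` becomes 1, which dehomogenizes. It serves to show
that the form is nonzero. -/
theorem aeval_homogenization (j : ι) (P : K[X]) :
    MvPolynomial.aeval ![1 + C (c j) * X, X] (homogenization c j P) = P := by
  conv_rhs => rw [P.as_sum_range_C_mul_X_pow]
  simp [homogenization, ← Polynomial.algebraMap_eq]

theorem homogenization_ne_zero (j : ι) {P : K[X]} (hP : P ≠ 0) : homogenization c j P ≠ 0 := by
  intro h
  apply hP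
  rw [← aeval_homogenization c j P, h, map_zero]

theorem order_homogenization (j : ι) {P : K[X]} (hP : P ≠ 0) :
    (homogenization c j P : MvPowerSeries (Fin 2) K).order = P.natDegree := by
  rw [MvPowerSeries.order_eq_nat]
  obtain ⟨d, hd⟩ := MvPolynomial.ne_zero_iff.1 (homogenization_ne_zero c j hP)
  refine ⟨⟨d, by simpa using hd, ?_⟩, fun d hd => ?_⟩
  · by_contra h
    exact hd ((isHomogeneous_homogenization c j P).coeff_eq_zero h)
  · simpa using (isHomogeneous_homogenization c j P).coeff_eq_zero hd.ne

theorem t_pow_mul_evalZ (j : ι) (P : K[X]) :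
    t c j ^ P.natDegree * evalZ c j P =
      algebraMap (MvPowerSeries (Fin 2) K) (E K) (homogenization c j P) := by
  have hsub : ((MvPolynomial.X 0 - MvPolynomial.C (c j) * MvPolynomial.X 1 :
      MvPolynomial (Fin 2) K) : MvPowerSeries (Fin 2) K) = tSeries c j := by
    rw [← MvPolynomial.coeToMvPowerSeries.ringHom_apply, map_sub]
    simp [tSeries]
  have : ((homogenization c j P : MvPolynomial (Fin 2) K) : MvPowerSeries (Fin 2) K) =
      ∑ i ∈ Finset.range (P.natDegree + 1), MvPowerSeries.C (P.coeff i) * (MvPowerSeries.X 1 ^ i *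
        tSeries c j ^ (P.natDegree - i)) := by
    rw [← MvPolynomial.coeToMvPowerSeries.ringHom_apply, homogenization, map_sum]
    simp [hsub]
  rw [this, evalZ, aeval_eq_sum_range, map_sum, Finset.mul_sum]
  refine Finset.sum_congr rfl fun i hi => ?_
  have hi' : i ≤ P.natDegree := by simpa [Nat.lt_succ_iff] using hi
  rw [map_mul, map_mul, map_pow, map_pow, ← z_mul_t c j, algebraMap_C, Algebra.smul_def, mul_pow]
  change _ = _ * (_ * t c j ^ _)
  obtain ⟨m, hm⟩ := Nat.exists_eq_add_of_le hi'
  rw [hm, Nat.add_sub_cancel_left, pow_add]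
  ring

/-- Multiplying by `t ^ deg P` gives a nonzero form of degree `deg P`, whose order cancels exactly
the value of the factor. -/
theorem v_evalZ (j : ι) {P : K[X]} (hP : P ≠ 0) : v K (evalZ c j P) = 1 := by
  have h := congrArg (v K) (t_pow_mul_evalZ c j P)
  rw [v_algebraMap, orderValuation_eq_exp (order_homogenization c j hP), map_mul, map_pow, v_t,
    ← WithZero.exp_nsmul] at h
  have h1 : (P.natDegree • (-1) : ℤ) = -(P.natDegree : ℤ) := by simp
  rw [h1] at h
  exact mul_left_cancel₀ WithZero.exp_ne_zero (h.trans (mul_one _).symm)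

/-! ### `R_J` as a localization of `K[z_j]` -/

/-- The polynomials whose values at `z_j` are invertible in `R_J`. -/
def invertiblePolys (J : Set ι) (j : ι) : Submonoid K[X] where
  carrier := {m | ∃ r ∈ zRing c J, r * evalZ c j m = 1}
  one_mem' := ⟨1, one_mem _, by simp⟩
  mul_mem' := by
    rintro a b ⟨r, hr, hra⟩ ⟨q, hq, hqb⟩
    exact ⟨r * q, mul_mem hr hq, by rw [map_mul]; linear_combination (q * evalZ c j b) * hra + hqb⟩

theorem evalZ_mem_zRing {J : Set ι} {j : ι} (hj : j ∈ J) (P : K[X]) :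
    evalZ c j P ∈ zRing c J := by
  have h : Algebra.adjoin K {z c j} ≤ zRing c J :=
    Algebra.adjoin_le (by simpa using z_mem_zRing c hj)
  exact h (aeval_mem_adjoin_singleton K (z c j))

theorem mem_invertiblePolys_of_dvd {J : Set ι} {j : ι} (hj : j ∈ J) {a b : K[X]} (hab : a ∣ b)
    (hb : b ∈ invertiblePolys c J j) : a ∈ invertiblePolys c J j := by
  obtain ⟨d, rfl⟩ := hab
  obtain ⟨r, hr, h⟩ := hb
  exact ⟨r * evalZ c j d, mul_mem hr (evalZ_mem_zRing c hj d), by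
    rw [map_mul] at h; linear_combination h⟩

theorem t_eq_t_add (j k : ι) :
    t c k = t c j + algebraMap K (E K) (c j - c k) *
      algebraMap (MvPowerSeries (Fin 2) K) (E K) (MvPowerSeries.X 1) := by
  simp [t, tSeries, algebraMap_C]
  ring

/-- The second factor is `t_k / t_j`. -/
theorem z_mul_eq (j k : ι) : z c k * (1 + algebraMap K (E K) (c j - c k) * z c j) = z c j := by
  have h := t_eq_t_add c j k
  have hj := t_ne_zero c j
  have hk := t_ne_zero c k
  rw [z, z, ← mul_div_assoc, one_add_div hj, ← h]
  field_simp

theorem one_add_mul_one_add (j k : ι) :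
    (1 + algebraMap K (E K) (c k - c j) * z c k) *
      (1 + algebraMap K (E K) (c j - c k) * z c j) = 1 := by
  have := z_mul_eq c j k
  have h : algebraMap K (E K) (c k - c j) = - algebraMap K (E K) (c j - c k) := by
    rw [← map_neg, neg_sub]
  rw [h]
  linear_combination (-algebraMap K (E K) (c j - c k)) * this

/-- Fractions `a(z_j) / m(z_j)` with denominator invertible in `R_J` are stable under sums and
products. The generator `z_k` has this form, the inverse of its denominator `t_k / t_j` being `t_j /
t_k = 1 + (c_k - c_j) z_k`. -/
theorem exists_mul_evalZ_eq {J : Set ι} (j : ι) {r : E K} (hr : r ∈ zRing c J) :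
    ∃ m ∈ invertiblePolys c J j, ∃ a : K[X], r * evalZ c j m = evalZ c j a := by
  induction hr using Algebra.adjoin_induction with
  | mem x hx =>
    obtain ⟨k, hk, rfl⟩ := hx
    have he : evalZ c j (1 + C (c j - c k) * X) =
        1 + algebraMap K (E K) (c j - c k) * z c j := by
      rw [evalZ, map_add, map_mul, map_one, aeval_C, aeval_X]
    refine ⟨1 + C (c j - c k) * X, ⟨1 + algebraMap K (E K) (c k - c j) * z c k,
      add_mem (one_mem _) (mul_mem (Subalgebra.algebraMap_mem _ _) (z_mem_zRing c hk)), ?_⟩,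
      X, ?_⟩
    · rw [he, one_add_mul_one_add]
    · rw [he, z_mul_eq]; simp [evalZ]
  | algebraMap r => exact ⟨1, one_mem _, C r, by simp [evalZ]⟩
  | add x y _ _ hx hy =>
    obtain ⟨m, hm, a, h⟩ := hx
    obtain ⟨n, hn, b, h'⟩ := hy
    exact ⟨m * n, mul_mem hm hn, a * n + b * m, by
      simp only [map_mul, map_add]
      linear_combination evalZ c j n * h + evalZ c j m * h'⟩
  | mul x y _ _ hx hy =>
    obtain ⟨m, hm, a, h⟩ := hx
    obtain ⟨n, hn, b, h'⟩ := hy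
    exact ⟨m * n, mul_mem hm hn, a * b, by
      simp only [map_mul]
      linear_combination (y * evalZ c j n) * h + evalZ c j a * h'⟩

theorem v_eq_one_of_mem_zRing {J : Set ι} (j : ι) {r : E K} (hr : r ∈ zRing c J)
    (h0 : r ≠ 0) : v K r = 1 := by
  obtain ⟨m, ⟨q, -, hq⟩, a, h⟩ := exists_mul_evalZ_eq c j hr
  have hm : evalZ c j m ≠ 0 := right_ne_zero_of_mul_eq_one hq
  have hm0 : m ≠ 0 := by rintro rfl; simp at hm
  have ha0 : a ≠ 0 := by
    rintro rfl
    rw [map_zero] at h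
    exact mul_ne_zero h0 hm h
  simpa [v_evalZ c j hm0, v_evalZ c j ha0] using congrArg (v K) h

/-- Collect in `m` the irreducible factors that become invertible. Any other irreducible factor
divides no invertible polynomial, because divisors of these are invertible too. -/
theorem exists_factorization {J : Set ι} {j : ι} (hj : j ∈ J) {N : K[X]} (hN : N ≠ 0) :
    ∃ P m : K[X], N = P * m ∧ m ∈ invertiblePolys c J j ∧
      ∀ m' ∈ invertiblePolys c J j, IsCoprime P m' := by
  induction N using WfDvdMonoid.induction_on_irreducible with
  | zero => exact absurd rfl hN
  | unit u hu =>
    exact ⟨1, u, by simp, mem_invertiblePolys_of_dvd c hj hu.dvd (one_mem _),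
      fun _ _ => isCoprime_one_left⟩
  | mul a p ha hp ih =>
    obtain ⟨P, m, rfl, hm, hP⟩ := ih ha
    by_cases hpM : p ∈ invertiblePolys c J j
    · exact ⟨P, p * m, by ring, mul_mem hpM hm, hP⟩
    · refine ⟨p * P, m, by ring, hm, fun m' hm' => IsCoprime.mul_left ?_ (hP m' hm')⟩
      exact (hp.coprime_iff_not_dvd).2 fun hd => hpM (mem_invertiblePolys_of_dvd c hj hd hm')

/-- Up to a unit, a nonzero element of `R_J` is a polynomial `P` in `z_j` such that the polynomials
of smaller degree represent all residue classes. -/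
theorem exists_division_zRing {J : Set ι} {j : ι} (hj : j ∈ J) {g : E K} (hg : g ∈ zRing c J)
    (hg0 : g ≠ 0) :
    ∃ P : K[X], (∃ W ∈ zRing c J, ∃ W' ∈ zRing c J, W * W' = 1 ∧ g = W * evalZ c j P) ∧
      ∀ r ∈ zRing c J, ∃ q : K[X], q.degree < P.degree ∧ ∃ h ∈ zRing c J,
        r = evalZ c j q + g * h := by
  obtain ⟨m, ⟨m', hm', hmm'⟩, N, hN⟩ := exists_mul_evalZ_eq c j hg
  have hN0 : N ≠ 0 := by
    rintro rfl
    rw [map_zero] at hN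
    exact mul_ne_zero hg0 (right_ne_zero_of_mul_eq_one hmm') hN
  obtain ⟨P, n, rfl, ⟨n', hn', hnn'⟩, hP⟩ := exists_factorization c hj hN0
  have hP0 : P ≠ 0 := left_ne_zero_of_mul hN0
  rw [map_mul] at hN
  have hgP : g = m' * evalZ c j n * evalZ c j P := by
    linear_combination m' * hN - g * hmm'
  have hPg : evalZ c j P = g * (n' * evalZ c j m) := by
    linear_combination -evalZ c j P * hnn' - n' * hN
  refine ⟨P, ⟨_, mul_mem hm' (evalZ_mem_zRing c hj n), _, mul_mem hn' (evalZ_mem_zRing c hj m), by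
    linear_combination n' * evalZ c j n * hmm' + hnn', hgP⟩, fun r hr => ?_⟩
  obtain ⟨s, hs, a, hsa⟩ := exists_mul_evalZ_eq c j hr
  -- From `αP + βs = 1` and `r s = a` at `z_j` it follows that `r = αPr + βa`. So `r` is congruent
  -- modulo `P` to the polynomial `βa`, which is then reduced by Euclidean division.
  obtain ⟨α, β, hαβ⟩ := hP s hs
  have hαβ' := congrArg (evalZ c j) hαβ
  simp only [map_add, map_mul, map_one] at hαβ'
  have hdiv := congrArg (evalZ c j) (EuclideanDomain.div_add_mod (β * a) P)
  simp only [map_add, map_mul] at hdiv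
  refine ⟨(β * a) % P, EuclideanDomain.mod_lt _ hP0,
    n' * evalZ c j m * (evalZ c j (β * a / P) + evalZ c j α * r), mul_mem
    (mul_mem hn' (evalZ_mem_zRing c hj m)) (add_mem (evalZ_mem_zRing c hj _)
      (mul_mem (evalZ_mem_zRing c hj _) hr)), ?_⟩
  linear_combination -r * hαβ' + evalZ c j β * hsa - hdiv +
    (evalZ c j (β * a / P) + evalZ c j α * r) * hPg

/-! ### Leading coefficients and units in `D_J` -/

theorem mem_D_iff {J : Set ι} {x : Ehat K} :
    x ∈ D c J ↔ ∀ n : ℕ, ∃ y ∈ polyRing c J,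
      vHat K (x - incl K y) ≤ WithZero.exp (-(n : ℤ)) := by
  have : x ∈ D c J ↔ x ∈ closure (incl K '' (polyRing c J : Set (E K))) := Iff.rfl
  rw [this, vHat_mem_closure_iff]
  simp

theorem mem_D_of_mul {J : Set ι} {x a : Ehat K} (ha : a ≠ 0)
    (h : ∀ n : ℕ, ∃ y ∈ D c J, vHat K (a * (x - y)) ≤ WithZero.exp (-(n : ℤ))) : x ∈ D c J :=
  (Subring.isClosed_topologicalClosure _).closure_subset
    (mem_closure_of_vHat_mul_le (S := (D c J : Set (Ehat K))) ha h)

theorem incl_mem_D {J : Set ι} {y : E K} (hy : y ∈ polyRing c J) : incl K y ∈ D c J :=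
  Subring.le_topologicalClosure _ ⟨y, hy, rfl⟩

theorem zRing_incl_mem_D {J : Set ι} {y : E K} (hy : y ∈ zRing c J) : incl K y ∈ D c J :=
  incl_mem_D c (zRing_le_polyRing c J hy)

theorem t_incl_mem_D (J : Set ι) (j : ι) : incl K (t c j) ∈ D c J :=
  incl_mem_D c (t_mem_polyRing c J j)

theorem vHat_t (i : ι) : vHat K (incl K (t c i)) = WithZero.exp (-1) := by
  rw [vHat_incl, v_t]

theorem incl_t_ne_zero (i : ι) : incl K (t c i) ≠ 0 :=
  (_root_.map_ne_zero _).2 (t_ne_zero c i)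

theorem v_zRing_le_one {J : Set ι} (j : ι) {r : E K} (hr : r ∈ zRing c J) : v K r ≤ 1 := by
  by_cases h0 : r = 0
  · simp [h0]
  · exact (v_eq_one_of_mem_zRing c j hr h0).le

theorem v_polyRing_le_one {J : Set ι} (j : ι) {y : E K} (hy : y ∈ polyRing c J) :
    v K y ≤ 1 := by
  induction hy using Algebra.adjoin_induction with
  | mem x hx =>
    rcases hx with ⟨k, hk, rfl⟩ | rfl | rfl
    · exact v_zRing_le_one c j (z_mem_zRing c hk)
    · rw [v_algebraMap]; exact orderValuation_le_one _
    · rw [v_algebraMap]; exact orderValuation_le_one _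
  | algebraMap r => exact v_zRing_le_one c j (Subalgebra.algebraMap_mem (zRing c J) r)
  | add x y _ _ hx hy => exact Valuation.map_add_le _ hx hy
  | mul x y _ _ hx hy => rw [map_mul]; exact mul_le_one' hx hy

theorem vHat_le_one_of_mem_D {J : Set ι} (j : ι) {x : Ehat K} (hx : x ∈ D c J) :
    vHat K x ≤ 1 := by
  obtain ⟨y, hy, h⟩ := (mem_D_iff c).1 hx 0
  rw [← sub_add_cancel x (incl K y)]
  refine Valuation.map_add_le _ (by simpa using h) ?_
  rw [vHat_incl]
  exact v_polyRing_le_one c j hy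

theorem vHat_t_mul_le_one_sub {x : Ehat K} (j : ι) {n : ℕ}
    (h : vHat K (incl K (t c j) * x) ≤ WithZero.exp (-((n + 1 : ℕ) : ℤ))) :
    vHat K x ≤ WithZero.exp (-(n : ℤ)) := by
  rw [map_mul, vHat_t] at h
  have : WithZero.exp (-((n + 1 : ℕ) : ℤ)) = WithZero.exp (-1) * WithZero.exp (-(n : ℤ)) := by
    rw [← WithZero.exp_add]; push_cast; ring_nf
  rw [this] at h
  exact (mul_le_mul_iff_right₀ WithZero.exp_pos).1 h

theorem exp_neg_lt_one {n : ℕ} (hn : 0 < n) : (WithZero.exp (-(n : ℤ)) : ℤᵐ⁰) < 1 := by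
  rw [← WithZero.exp_zero, WithZero.exp_lt_exp]
  omega

theorem vHat_t_mul_lt_one {x : Ehat K} (j : ι) (hx : vHat K x ≤ 1) :
    vHat K (incl K (t c j) * x) < 1 := by
  rw [map_mul, vHat_t]
  exact (mul_le_of_le_one_right' hx).trans_lt (by simpa using exp_neg_lt_one one_pos)

theorem exists_eq_add_t_mul {J : Set ι} {j : ι} (hj : j ∈ J) {f : Ehat K} (hf : f ∈ D c J) :
    ∃ r ∈ zRing c J, ∃ f' ∈ D c J, f = incl K r + incl K (t c j) * f' := by
  choose y hy hfy using (mem_D_iff c).1 hf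
  choose r hr y' hy' hyr using fun n => exists_eq_add_t_mul_of_mem_polyRing c hj (hy (n + 1))
  -- A nonzero difference of two constant terms would have value 1, but all approximants agree
  -- modulo values below 1. Hence the constant term never changes.
  have hrr : ∀ n, r n = r 0 := by
    intro n
    by_contra hne
    have h1 := v_eq_one_of_mem_zRing c j (sub_mem (hr n) (hr 0)) (sub_ne_zero.2 hne)
    have h2 : incl K (r n - r 0) = (f - incl K (y 1)) - (f - incl K (y (n + 1))) +
        incl K (t c j) * incl K (y' 0 - y' n) := by
      have e0 := hyr 0
      rw [zero_add] at e0
      rw [hyr n, e0]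
      simp only [map_sub, map_add, map_mul]
      ring
    have h3 : vHat K (incl K (r n - r 0)) < 1 := by
      rw [h2]
      refine Valuation.map_add_lt _ (Valuation.map_sub_lt _ ((hfy 1).trans_lt ?_)
        ((hfy (n + 1)).trans_lt ?_)) (vHat_t_mul_lt_one c j ?_)
      · exact exp_neg_lt_one one_pos
      · exact exp_neg_lt_one (Nat.succ_pos n)
      · rw [vHat_incl]; exact v_polyRing_le_one c j (sub_mem (hy' 0) (hy' n))
    rw [vHat_incl, h1] at h3
    exact lt_irrefl _ h3
  refine ⟨r 0, hr 0, (f - incl K (r 0)) / incl K (t c j), ?_, ?_⟩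
  · rw [mem_D_iff]
    refine fun n => ⟨y' n, hy' n, vHat_t_mul_le_one_sub c j ((le_of_eq ?_).trans (hfy (n + 1)))⟩
    rw [hyr n, hrr n, mul_sub, mul_div_cancel₀ _ (incl_t_ne_zero c j)]
    congr 1
    simp only [map_add, map_mul]
    ring
  · rw [mul_div_cancel₀ _ (incl_t_ne_zero c j)]
    ring

/-- Factors `t` are split off while the constant term vanishes; the finite value of `g` bounds their
number. -/
theorem exists_eq_t_pow_mul {J : Set ι} {j : ι} (hj : j ∈ J) {g : Ehat K} (hg : g ∈ D c J)
    (hg0 : g ≠ 0) :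
    ∃ m : ℕ, ∃ r ∈ zRing c J, r ≠ 0 ∧ ∃ g' ∈ D c J,
      g = incl K (t c j) ^ m * (incl K r + incl K (t c j) * g') := by
  obtain ⟨n, hn⟩ := exists_exp_lt (γ := vHat K g) (by simpa using hg0)
  induction n generalizing g with
  | zero =>
    have := vHat_le_one_of_mem_D c j hg
    simp only [CharP.cast_eq_zero, neg_zero, WithZero.exp_zero] at hn
    exact absurd this (not_le.2 hn)
  | succ n ih =>
    obtain ⟨r, hr, g', hg', rfl⟩ := exists_eq_add_t_mul c hj hg
    by_cases hr0 : r = 0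
    · subst hr0
      rw [map_zero, zero_add] at hg0 hn ⊢
      have hn' : WithZero.exp (-(n : ℤ)) < vHat K g' := by
        by_contra hle
        have := mul_le_mul_right (not_lt.1 hle) (vHat K (incl K (t c j)))
        rw [← map_mul, vHat_t, ← WithZero.exp_add] at this
        refine absurd hn (not_lt.2 (this.trans (le_of_eq ?_)))
        push_cast
        ring_nf
      obtain ⟨m, r, hr, hr0, g'', hg'', h⟩ := ih hg' (right_ne_zero_of_mul hg0) hn'
      exact ⟨m + 1, r, hr, hr0, g'', hg'', by rw [h]; ring⟩
    · exact ⟨0, r, hr, hr0, g', hg', by simp⟩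

/-- Geometric series: its partial sums lie in `D_J` and approximate the inverse. -/
theorem exists_mul_one_add_t_mul_eq_one {J : Set ι} (j : ι) {h : Ehat K}
    (hh : h ∈ D c J) : ∃ u ∈ D c J, u * (1 + incl K (t c j) * h) = 1 := by
  set x := -(incl K (t c j) * h) with hx
  have hxD : x ∈ D c J := neg_mem (mul_mem (t_incl_mem_D c J j) hh)
  have hvx : vHat K x ≤ WithZero.exp (-1) := by
    rw [hx, Valuation.map_neg, map_mul, vHat_t]
    exact mul_le_of_le_one_right' (vHat_le_one_of_mem_D c j hh)
  have h1 : 1 + incl K (t c j) * h = 1 - x := by rw [hx]; ring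
  have h0 : 1 - x ≠ 0 := by
    intro h0
    have : vHat K x = 1 := by rw [← sub_eq_zero.1 h0, map_one]
    rw [this] at hvx
    exact absurd hvx (not_le.2 (by simpa using exp_neg_lt_one one_pos))
  rw [h1]
  refine ⟨(1 - x)⁻¹, mem_D_of_mul c h0 fun n => ⟨∑ i ∈ Finset.range n, x ^ i,
    sum_mem fun i _ => pow_mem hxD i, ?_⟩, inv_mul_cancel₀ h0⟩
  rw [mul_sub, mul_inv_cancel₀ h0, mul_neg_geom_sum, sub_sub_cancel, map_pow]
  refine (pow_le_pow_left' hvx n).trans (le_of_eq ?_)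
  rw [← WithZero.exp_nsmul]
  simp

/-! ### Power series in `t` -/

/-- The embedding of `K[[t]]` for `t = X - c_j Y`. -/
def powerSeriesHom (j : ι) : PowerSeries K →+* E K :=
  (algebraMap (MvPowerSeries (Fin 2) K) (E K)).comp
    (PowerSeries.substAlgHom (R := K) (hasSubst_tSeries c j)).toRingHom

theorem powerSeriesHom_apply (j : ι) (p : PowerSeries K) :
    powerSeriesHom c j p = algebraMap (MvPowerSeries (Fin 2) K) (E K) (p.subst (tSeries c j)) := by
  rw [← PowerSeries.coe_substAlgHom (hasSubst_tSeries c j)]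
  rfl

theorem powerSeriesHom_X (j : ι) : powerSeriesHom c j PowerSeries.X = t c j := by
  rw [powerSeriesHom_apply, PowerSeries.subst_X (hasSubst_tSeries c j)]; rfl

theorem powerSeriesHom_C (j : ι) (a : K) :
    powerSeriesHom c j (PowerSeries.C a) = algebraMap K (E K) a := by
  rw [powerSeriesHom_apply, PowerSeries.subst_C, algebraMap_C]

theorem v_powerSeriesHom_le_one (j : ι) (p : PowerSeries K) : v K (powerSeriesHom c j p) ≤ 1 := by
  rw [powerSeriesHom_apply, v_algebraMap]
  exact orderValuation_le_one _

theorem algebraMap_mvPolynomial_mem_polyRing (J : Set ι) (p : MvPolynomial (Fin 2) K) :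
    algebraMap (MvPowerSeries (Fin 2) K) (E K) p ∈ polyRing c J := by
  induction p using MvPolynomial.induction_on with
  | C a =>
    rw [MvPolynomial.coe_C, algebraMap_C]
    exact Subalgebra.algebraMap_mem _ a
  | add p q hp hq => rw [MvPolynomial.coe_add, map_add]; exact add_mem hp hq
  | mul_X p i hp =>
    rw [MvPolynomial.coe_mul, map_mul, MvPolynomial.coe_X]
    refine mul_mem hp (Algebra.subset_adjoin (Or.inr ?_))
    fin_cases i <;> simp

theorem incl_algebraMap_mem_D (J : Set ι) (f : MvPowerSeries (Fin 2) K) :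
    incl K (algebraMap _ (E K) f) ∈ D c J := by
  rw [mem_D_iff]
  refine fun n => ⟨_, algebraMap_mvPolynomial_mem_polyRing c J (f.truncTotal n), ?_⟩
  rw [← map_sub, ← map_sub, vHat_incl, v_algebraMap, orderValuation_le_exp_iff]
  refine MvPowerSeries.nat_le_order fun d hd => ?_
  rw [map_sub, MvPolynomial.coeff_coe, MvPowerSeries.coeff_truncTotal _ hd, sub_self]

theorem powerSeriesHom_mem_adjoin (j : ι) (p : PowerSeries K) :
    powerSeriesHom c j p ∈ Algebra.adjoin (powerSeriesRing c j) {z c j} :=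
  Subalgebra.algebraMap_mem (Algebra.adjoin (powerSeriesRing c j) {z c j})
    (⟨_, p, rfl⟩ : powerSeriesRing c j)

theorem powerSeriesHom_mk (j : ι) (a : ℕ → K) :
    powerSeriesHom c j (PowerSeries.mk a) =
      algebraMap K (E K) (a 0) + t c j * powerSeriesHom c j (PowerSeries.mk fun n => a (n + 1)) := by
  rw [← powerSeriesHom_X, ← powerSeriesHom_C, ← map_mul, ← map_add]
  congr 1
  have := PowerSeries.eq_X_mul_shift_add_const (PowerSeries.mk a)
  simpa [add_comm] using this

/-- A sequence of polynomials `q_n` in `z_j` of bounded degree sums to `∑ q_n t ^ n` in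
`K[[t]][z_j]`. -/
theorem exists_sum_evalZ_mul_t_pow (j : ι) (N : ℕ) (q : ℕ → K[X])
    (hq : ∀ n, (q n).natDegree < N) :
    ∃ S : ℕ → E K, ∀ n, S n ∈ Algebra.adjoin (powerSeriesRing c j) {z c j} ∧ v K (S n) ≤ 1 ∧
      S n = evalZ c j (q n) + t c j * S (n + 1) := by
  -- `S n` is the tail `∑ q_{n+i} t ^ i`, rearranged by powers of `z_j`. The degree bound leaves
  -- finitely many powers, each with a coefficient in `K[[t]]`.
  refine ⟨fun n => ∑ l ∈ Finset.range N,
    powerSeriesHom c j (PowerSeries.mk fun i => (q (n + i)).coeff l) * z c j ^ l,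
    fun n => ⟨?_, ?_, ?_⟩⟩
  · exact Subalgebra.sum_mem _ fun l _ => Subalgebra.mul_mem _ (powerSeriesHom_mem_adjoin c j _)
      (Subalgebra.pow_mem _ (Algebra.subset_adjoin (Set.mem_singleton _)) l)
  · refine Valuation.map_sum_le _ fun l _ => ?_
    rw [map_mul, map_pow]
    exact mul_le_one' (v_powerSeriesHom_le_one c j _)
      (pow_le_one' (v_zRing_le_one c j (z_mem_zRing c (Set.mem_singleton j))) l)
  · rw [evalZ, aeval_eq_sum_range' (hq n), Finset.mul_sum, ← Finset.sum_add_distrib]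
    refine Finset.sum_congr rfl fun l _ => ?_
    rw [powerSeriesHom_mk, Algebra.smul_def]
    simp only [add_zero, add_assoc, add_comm 1]
    ring

/-! ### Weierstrass division and preparation -/

/-- Only the constant term is divided, by `r`. Using `r + t g` as divisor instead changes the result
by a multiple of `t`, which the tail `f'` absorbs. -/
theorem exists_division_step {J : Set ι} {j : ι} (hj : j ∈ J) {r : E K} {P : K[X]}
    (hP : ∀ s ∈ zRing c J, ∃ q : K[X], q.degree < P.degree ∧ ∃ h ∈ zRing c J,
      s = evalZ c j q + r * h) {g : Ehat K} (hg : g ∈ D c J) (f : D c J) :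
    ∃ q : K[X], q.degree < P.degree ∧ ∃ h ∈ zRing c J, ∃ f' : D c J,
      (f : Ehat K) = incl K (evalZ c j q) + (incl K r + incl K (t c j) * g) * incl K h +
        incl K (t c j) * f' := by
  obtain ⟨f, hf⟩ := f
  obtain ⟨s, hs, f', hf', rfl⟩ := exists_eq_add_t_mul c hj hf
  obtain ⟨q, hq, h, hh, rfl⟩ := hP s hs
  refine ⟨q, hq, h, hh, ⟨f' - g * incl K h,
    sub_mem hf' (mul_mem hg (zRing_incl_mem_D c hh))⟩, ?_⟩
  simp only [map_add, map_mul]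
  ring

theorem add_t_mul_ne_zero {J : Set ι} {j : ι} {r : E K} (hr : r ∈ zRing c J)
    (hr0 : r ≠ 0) {g : Ehat K} (hg : g ∈ D c J) : incl K r + incl K (t c j) * g ≠ 0 := by
  intro h0
  have h1 : incl K r = -(incl K (t c j) * g) := by linear_combination h0
  have h2 := vHat_t_mul_lt_one c j (vHat_le_one_of_mem_D c j hg)
  rw [← Valuation.map_neg, ← h1, vHat_incl, v_eq_one_of_mem_zRing c j hr hr0] at h2
  exact lt_irrefl _ h2

/-- Weierstrass division in `D_J` by an element with nonzero leading coefficient. -/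
theorem exists_weierstrass_division {J : Set ι} {j : ι} (hj : j ∈ J) {r : E K}
    (hr : r ∈ zRing c J) (hr0 : r ≠ 0) {g : Ehat K} (hg : g ∈ D c J) {f : Ehat K}
    (hf : f ∈ D c J) :
    ∃ p ∈ Algebra.adjoin (powerSeriesRing c j) {z c j}, ∃ h ∈ D c J,
      f = incl K p + (incl K r + incl K (t c j) * g) * h := by
  obtain ⟨P, -, hP⟩ := exists_division_zRing c hj hr hr0
  choose q hq h hh F hF using exists_division_step c hj hP hg
  have hG0 := add_t_mul_ne_zero c (j := j) hr hr0 hg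
  generalize incl K r + incl K (t c j) * g = G at hF hG0 ⊢
  obtain ⟨x, hx, hx0⟩ : ∃ x : ℕ → D c J, (∀ n, x (n + 1) = F (x n)) ∧ (x 0 : Ehat K) = f :=
    ⟨fun n => F^[n] ⟨f, hf⟩, fun n => Function.iterate_succ_apply' F n _, rfl⟩
  -- The `+ 1` covers constant `P`: then every remainder is 0, whose `natDegree` is 0.
  obtain ⟨S, hS⟩ := exists_sum_evalZ_mul_t_pow c j (P.natDegree + 1) (fun n => q (x n))
    fun n => Nat.lt_succ_of_le (Polynomial.natDegree_le_natDegree (hq _).le)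
  have key : ∀ n : ℕ, ∃ y ∈ D c J,
      f - incl K (S 0) = G * y + incl K (t c j) ^ n * (x n - incl K (S n)) := by
    intro n
    induction n with
    | zero => exact ⟨0, zero_mem _, by rw [hx0]; ring⟩
    | succ n ih =>
      obtain ⟨y, hy, hxe⟩ := ih
      refine ⟨y + incl K (t c j) ^ n * incl K (h (x n)), add_mem hy
        (mul_mem (pow_mem (t_incl_mem_D c J j) n) (zRing_incl_mem_D c (hh _))), ?_⟩
      have hS' := congrArg (incl K) (hS n).2.2
      rw [map_add, map_mul] at hS'
      have hF' := hF (x n)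
      rw [← hx n] at hF'
      linear_combination hxe + incl K (t c j) ^ n * (hF' - hS')
  -- By `key`, `f - S 0` is a multiple of `G` up to value `exp (-n)`. Since `D_J` is closed, the
  -- quotient by `G` lies in it, although `G` need not be a unit there.
  refine ⟨S 0, (hS 0).1, (f - incl K (S 0)) / G, mem_D_of_mul c hG0 fun n => ?_, ?_⟩
  · obtain ⟨y, hy, hxe⟩ := key n
    refine ⟨y, hy, ?_⟩
    have : G * ((f - incl K (S 0)) / G - y) =
        incl K (t c j) ^ n * (x n - incl K (S n)) := by
      rw [mul_sub, mul_div_cancel₀ _ hG0]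
      linear_combination hxe
    rw [this, map_mul, vHat_t_pow]
    refine mul_le_of_le_one_right' (Valuation.map_sub_le _ (vHat_le_one_of_mem_D c j (x n).2) ?_)
    rw [vHat_incl]
    exact (hS n).2.1
  · rw [mul_div_cancel₀ _ hG0]
    ring

theorem evalZ_mem_adjoin (j : ι) (P : K[X]) :
    evalZ c j P ∈ Algebra.adjoin (powerSeriesRing c j) {z c j} := by
  rw [evalZ, aeval_eq_sum_range]
  refine Subalgebra.sum_mem _ fun i _ => ?_
  rw [Algebra.smul_def, ← powerSeriesHom_C]
  exact Subalgebra.mul_mem _ (powerSeriesHom_mem_adjoin c j _)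
    (Subalgebra.pow_mem _ (Algebra.subset_adjoin (Set.mem_singleton _)) i)

theorem t_mem_adjoin (j : ι) : t c j ∈ Algebra.adjoin (powerSeriesRing c j) {z c j} := by
  rw [← powerSeriesHom_X]
  exact powerSeriesHom_mem_adjoin c j _

/-- Weierstrass preparation in `D_J`. -/
theorem exists_weierstrass_preparation {J : Set ι} {j : ι} (hj : j ∈ J) {f : Ehat K}
    (hf : f ∈ D c J) :
    ∃ p ∈ Algebra.adjoin (powerSeriesRing c j) {z c j}, ∃ u : (D c J)ˣ,
      f = incl K p * ((u : D c J) : Ehat K) := by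
  by_cases hf0 : f = 0
  · exact ⟨0, Subalgebra.zero_mem _, 1, by rw [hf0, map_zero, zero_mul]⟩
  obtain ⟨m, r, hr, hr0, g, hg, rfl⟩ := exists_eq_t_pow_mul c hj hf hf0
  obtain ⟨P, ⟨W, hW, W', hW', hWW', hrP⟩, -⟩ := exists_division_zRing c hj hr hr0
  have hWD := zRing_incl_mem_D c hW
  have hWD' := zRing_incl_mem_D c hW'
  -- The dividend `-g W'` is chosen so that `(r + t g)(W' + t h) = P(z_j) - t p`. The cofactor `W' +
  -- t h = W'(1 + t W h)` is a unit.
  obtain ⟨p, hp, h, hh, hdiv⟩ := exists_weierstrass_division c hj hr hr0 hg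
    (neg_mem (mul_mem hg hWD'))
  obtain ⟨u, hu, hu1⟩ := exists_mul_one_add_t_mul_eq_one c j (mul_mem hWD hh)
  have hWi : incl K W * incl K W' = 1 := by rw [← map_mul, hWW', map_one]
  have hri : incl K r = incl K W * incl K (evalZ c j P) := by rw [hrP, map_mul]
  let U : (D c J)ˣ :=
    { val := ⟨u * incl K W, mul_mem hu hWD⟩
      inv := ⟨incl K W' * (1 + incl K (t c j) * (incl K W * h)), mul_mem hWD'
        (add_mem (one_mem _) (mul_mem (t_incl_mem_D c J j) (mul_mem hWD hh)))⟩
      val_inv := Subtype.ext (by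
        change u * incl K W * (incl K W' * (1 + incl K (t c j) * (incl K W * h))) = 1
        linear_combination hu1 + u * (1 + incl K (t c j) * (incl K W * h)) * hWi)
      inv_val := Subtype.ext (by
        change incl K W' * (1 + incl K (t c j) * (incl K W * h)) * (u * incl K W) = 1
        linear_combination hu1 + u * (1 + incl K (t c j) * (incl K W * h)) * hWi) }
  refine ⟨t c j ^ m * (evalZ c j P - t c j * p), Subalgebra.mul_mem _
    (Subalgebra.pow_mem _ (t_mem_adjoin c j) m) (Subalgebra.sub_mem _ (evalZ_mem_adjoin c j P)
      (Subalgebra.mul_mem _ (t_mem_adjoin c j) hp)), U, ?_⟩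
  change _ = _ * (u * incl K W)
  simp only [map_mul, map_sub, map_pow]
  have hG : (incl K r + incl K (t c j) * g) * (incl K W' * (1 + incl K (t c j) *
      (incl K W * h))) = incl K (evalZ c j P) - incl K (t c j) * incl K p := by
    linear_combination (incl K W') * hri + (incl K (evalZ c j P) +
      (incl K r + incl K (t c j) * g) * incl K (t c j) * h) * hWi - incl K (t c j) * hdiv
  rw [← hG]
  linear_combination (-incl K (t c j) ^ m * (incl K r + incl K (t c j) * g)) * hu1 -
    incl K (t c j) ^ m * (incl K r + incl K (t c j) * g) * u *
      (1 + incl K (t c j) * (incl K W * h)) * hWi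

/-! ### Inverting `t` -/

theorem mem_DInv_iff {J : Set ι} {j : ι} {x : Ehat K} :
    x ∈ DInv c J j ↔ ∃ n : ℕ, incl K (t c j) ^ n * x ∈ D c J := by
  have ht := incl_t_ne_zero c j
  have htD := t_incl_mem_D c J j
  constructor
  · intro hx
    induction hx using Algebra.adjoin_induction with
    | mem x hx =>
      refine ⟨1, ?_⟩
      rw [Set.mem_singleton_iff.1 hx, pow_one, mul_inv_cancel₀ ht]
      exact one_mem _
    | algebraMap r => exact ⟨0, by rw [pow_zero, one_mul]; exact r.2⟩
    | add x y _ _ hx hy =>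
      obtain ⟨n, hn⟩ := hx
      obtain ⟨m, hm⟩ := hy
      refine ⟨n + m, ?_⟩
      have : incl K (t c j) ^ (n + m) * (x + y) = incl K (t c j) ^ m * (incl K (t c j) ^ n * x) +
        incl K (t c j) ^ n * (incl K (t c j) ^ m * y) := by ring
      rw [this]
      exact add_mem (mul_mem (pow_mem htD m) hn) (mul_mem (pow_mem htD n) hm)
    | mul x y _ _ hx hy =>
      obtain ⟨n, hn⟩ := hx
      obtain ⟨m, hm⟩ := hy
      refine ⟨n + m, ?_⟩
      have : incl K (t c j) ^ (n + m) * (x * y) =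
        (incl K (t c j) ^ n * x) * (incl K (t c j) ^ m * y) := by ring
      rw [this]
      exact mul_mem hn hm
  · rintro ⟨n, hn⟩
    have : x = algebraMap (D c J) (Ehat K) ⟨_, hn⟩ * (incl K (t c j))⁻¹ ^ n := by
      change x = incl K (t c j) ^ n * x * _
      rw [inv_pow]
      field_simp
    rw [this]
    exact Subalgebra.mul_mem _ (Subalgebra.algebraMap_mem _ _)
      (Subalgebra.pow_mem _ (Algebra.subset_adjoin (Set.mem_singleton _)) n)

theorem D_mem_DInv {J : Set ι} {j : ι} {x : Ehat K} (hx : x ∈ D c J) : x ∈ DInv c J j :=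
  (mem_DInv_iff c).2 ⟨0, by rwa [pow_zero, one_mul]⟩

/-- A nonzero power series is a power of its variable times a unit. Thus only powers of `t` are
needed as denominators in `K((t))`. -/
theorem exists_t_pow_mul_powerSeriesHom_eq_one {j : ι} {q : PowerSeries K} (hq : q ≠ 0) :
    ∃ (n : ℕ) (s : PowerSeries K),
      powerSeriesHom c j q * powerSeriesHom c j s = t c j ^ n := by
  refine ⟨q.order.toNat, PowerSeries.Inv_divided_by_X_pow_order hq, ?_⟩
  rw [← powerSeriesHom_X, ← map_mul, ← map_pow]
  congr 1
  conv_lhs => enter [1]; rw [← PowerSeries.X_pow_order_mul_divXPowOrder (f := q)]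
  rw [mul_assoc, PowerSeries.Inv_divided_by_X_pow_order_rightInv, mul_one]

theorem exists_t_pow_mul_eq_of_mem_laurentField {j : ι} {x : E K} (hx : x ∈ laurentField c j) :
    ∃ (n : ℕ) (p : PowerSeries K), t c j ^ n * x = powerSeriesHom c j p := by
  rw [laurentField, Subfield.mem_closure_iff, Subring.closure_eq] at hx
  obtain ⟨_, ⟨p, rfl⟩, _, ⟨q, rfl⟩, rfl⟩ := hx
  change ∃ (n : ℕ) (s : PowerSeries K),
    t c j ^ n * (powerSeriesHom c j p / powerSeriesHom c j q) = powerSeriesHom c j s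
  by_cases hq : q = 0
  · exact ⟨0, 0, by simp [hq]⟩
  · obtain ⟨n, s, hs⟩ := exists_t_pow_mul_powerSeriesHom_eq_one c (j := j) hq
    have hq0 : powerSeriesHom c j q ≠ 0 := by
      intro h
      rw [h, zero_mul] at hs
      exact pow_ne_zero n (t_ne_zero c j) hs.symm
    refine ⟨n, p * s, ?_⟩
    rw [← hs, map_mul]
    field_simp

theorem incl_mem_DInv_of_mem_adjoin {J : Set ι} {j : ι} {x : E K}
    (hx : x ∈ Algebra.adjoin (laurentField c j) (z c '' J)) : incl K x ∈ DInv c J j := by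
  induction hx using Algebra.adjoin_induction with
  | mem x hx => exact D_mem_DInv c (zRing_incl_mem_D c (Algebra.subset_adjoin hx))
  | algebraMap r =>
    obtain ⟨n, p, h⟩ := exists_t_pow_mul_eq_of_mem_laurentField c r.2
    refine (mem_DInv_iff c).2 ⟨n, ?_⟩
    change incl K (t c j) ^ n * incl K (r : E K) ∈ _
    rw [← map_pow, ← map_mul, h, powerSeriesHom_apply]
    exact incl_algebraMap_mem_D c J _
  | add x y _ _ hx hy => rw [map_add]; exact Subalgebra.add_mem _ hx hy
  | mul x y _ _ hx hy => rw [map_mul]; exact Subalgebra.mul_mem _ hx hy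

theorem powerSeriesRing_le_laurentField (j : ι) :
    (powerSeriesRing c j : Set (E K)) ⊆ laurentField c j :=
  Subfield.subset_closure

theorem mem_adjoin_laurentField {J : Set ι} {j : ι} (hj : j ∈ J) {p : E K}
    (hp : p ∈ Algebra.adjoin (powerSeriesRing c j) {z c j}) :
    p ∈ Algebra.adjoin (laurentField c j) (z c '' J) := by
  induction hp using Algebra.adjoin_induction with
  | mem x hx =>
    rw [Set.mem_singleton_iff.1 hx]
    exact Algebra.subset_adjoin ⟨j, hj, rfl⟩
  | algebraMap r =>
    exact Subalgebra.algebraMap_mem (Algebra.adjoin (laurentField c j) (z c '' J))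
      (⟨r, powerSeriesRing_le_laurentField c j r.2⟩ : laurentField c j)
  | add x y _ _ hx hy => exact Subalgebra.add_mem _ hx hy
  | mul x y _ _ hx hy => exact Subalgebra.mul_mem _ hx hy

theorem t_inv_pow_mem_adjoin (J : Set ι) (j : ι) (n : ℕ) :
    (t c j)⁻¹ ^ n ∈ Algebra.adjoin (laurentField c j) (z c '' J) := by
  have : t c j ∈ laurentField c j :=
    powerSeriesRing_le_laurentField c j ⟨PowerSeries.X, powerSeriesHom_X c j⟩
  exact Subalgebra.algebraMap_mem (Algebra.adjoin (laurentField c j) (z c '' J))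
    (⟨_, pow_mem (inv_mem this) n⟩ : laurentField c j)

theorem DInv_eq_add_smul {J : Set ι} {j : ι} (hj : j ∈ J) {g : Ehat K} (hg : g ∈ D c J)
    (hg0 : g ≠ 0) :
    (DInv c J j : Set (Ehat K)) =
      incl K '' (Algebra.adjoin (laurentField c j) (z c '' J) : Set (E K)) +
        g • (DInv c J j : Set (Ehat K)) := by
  have ht := incl_t_ne_zero c j
  ext x
  constructor
  · intro hx
    obtain ⟨n, hn⟩ := (mem_DInv_iff c).1 hx
    obtain ⟨m, r, hr, hr0, g', hg', rfl⟩ := exists_eq_t_pow_mul c hj hg hg0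
    -- The dividend is `t ^ n * x`, and the divisor is `g` stripped of `t ^ m`; both powers are
    -- restored by the factor `t⁻¹ ^ (n + m)` on `h`.
    obtain ⟨p, hp, h, hh, hdiv⟩ := exists_weierstrass_division c hj hr hr0 hg' hn
    refine Set.mem_add.2 ⟨_, ⟨p * (t c j)⁻¹ ^ n, Subalgebra.mul_mem _
      (mem_adjoin_laurentField c hj hp) (t_inv_pow_mem_adjoin c J j n), rfl⟩, _,
      ⟨h * (incl K (t c j))⁻¹ ^ (n + m), (mem_DInv_iff c).2 ⟨n + m, ?_⟩, rfl⟩, ?_⟩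
    · rw [mul_left_comm, ← mul_pow, mul_inv_cancel₀ ht, one_pow, mul_one]
      exact hh
    · refine mul_left_cancel₀ (pow_ne_zero n ht) ?_
      rw [hdiv]
      simp only [smul_eq_mul]
      simp only [map_mul, map_pow, map_inv₀, inv_pow, pow_add]
      field_simp
  · rintro ⟨_, ⟨a, ha, rfl⟩, _, ⟨b, hb, rfl⟩, rfl⟩
    exact Subalgebra.add_mem _ (incl_mem_DInv_of_mem_adjoin c ha)
      (Subalgebra.mul_mem _ (D_mem_DInv c hg) hb)

/-! ### The ring `Q_j` is a field -/

theorem exists_algebraMap_eq_of_mem_polyRing_empty {y : E K} (hy : y ∈ polyRing c ∅) :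
    ∃ f : MvPowerSeries (Fin 2) K, algebraMap _ (E K) f = y := by
  have : polyRing c ∅ ≤ (IsScalarTower.toAlgHom K (MvPowerSeries (Fin 2) K) (E K)).range := by
    refine Algebra.adjoin_le ?_
    rintro _ (⟨_, h, -⟩ | rfl | rfl)
    · exact h.elim
    · exact ⟨_, rfl⟩
    · exact ⟨_, rfl⟩
  exact this hy

theorem vHat_incl_algebraMap_le_iff (f : MvPowerSeries (Fin 2) K) (n : ℕ) :
    vHat K (incl K (algebraMap _ (E K) f)) ≤ WithZero.exp (-(n : ℤ)) ↔ (n : ℕ∞) ≤ f.order := by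
  rw [vHat_incl, v_algebraMap, orderValuation_le_exp_iff]

/-- Without any `z_k` the approximants are power series, and a limit in `K[[X, Y]]` exists because
each coefficient stabilizes. -/
theorem D_empty_le_range : D c ∅ ≤ (incl K).range := by
  intro x hx
  choose y hy hxy using (mem_D_iff c).1 hx
  choose f hf using fun n => exists_algebraMap_eq_of_mem_polyRing_empty c (hy n)
  have hcoeff : ∀ (d : Fin 2 →₀ ℕ) (n : ℕ), d.degree < n →
      MvPowerSeries.coeff d (f n) = MvPowerSeries.coeff d (f (d.degree + 1)) := by
    intro d n hd
    have h : ((d.degree + 1 : ℕ) : ℕ∞) ≤ (f n - f (d.degree + 1)).order := by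
      rw [← vHat_incl_algebraMap_le_iff, map_sub, map_sub, hf, hf,
        ← sub_sub_sub_cancel_left _ _ x]
      refine Valuation.map_sub_le _ (hxy _) ((hxy n).trans ?_)
      rw [WithZero.exp_le_exp]
      omega
    have h2 := MvPowerSeries.coeff_of_lt_order (f := f n - f (d.degree + 1)) (d := d)
      (lt_of_lt_of_le (by exact_mod_cast Nat.lt_succ_self _) h)
    rwa [map_sub, sub_eq_zero] at h2
  -- The approximant of index `d.degree + 1` is the first one guaranteed to have the final
  -- coefficient at `d`.
  let g : MvPowerSeries (Fin 2) K := fun d => MvPowerSeries.coeff d (f (d.degree + 1))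
  have hg : ∀ n : ℕ, (n : ℕ∞) ≤ (f n - g).order := fun n =>
    MvPowerSeries.nat_le_order fun d hd => by
      rw [map_sub, hcoeff d n hd]
      exact sub_self _
  refine ⟨algebraMap _ (E K) g, (sub_eq_zero.1 (eq_zero_of_vHat_le fun n => ?_)).symm⟩
  rw [← sub_add_sub_cancel x (incl K (y n))]
  refine Valuation.map_add_le _ (hxy n) ?_
  rw [← hf, ← map_sub, ← map_sub, vHat_incl_algebraMap_le_iff]
  exact hg n

/-- Denominators can be taken in `K[[X, Y]]`, which lies in every `D_J`; multiplying them handles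
sums and products. -/
theorem exists_mul_mem_D_of_mem_Q {j : ι} {x : Ehat K} (hx : x ∈ Q c j) :
    ∃ b : E K, b ≠ 0 ∧ incl K b * x ∈ D c {j}ᶜ := by
  suffices ∃ b : MvPowerSeries (Fin 2) K, b ≠ 0 ∧
      incl K (algebraMap _ (E K) b) * x ∈ D c {j}ᶜ by
    obtain ⟨b, hb, h⟩ := this
    exact ⟨_, (map_ne_zero_iff _ (IsFractionRing.injective _ _)).2 hb, h⟩
  have hD := incl_algebraMap_mem_D c {j}ᶜ
  have hQ : Q c j = Subring.closure (((incl K).range : Set (Ehat K)) ∪ D c {j}ᶜ) := by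
    rw [Subring.closure_union, Subring.closure_eq, Subring.closure_eq, Q]
  rw [hQ] at hx
  induction hx using Subring.closure_induction with
  | mem x hx =>
    rcases hx with ⟨e, rfl⟩ | hx
    · obtain ⟨a, b, hb, rfl⟩ := IsFractionRing.div_surjective (A := MvPowerSeries (Fin 2) K) e
      have hb0 := nonZeroDivisors.ne_zero hb
      have hb1 := (map_ne_zero_iff _ (IsFractionRing.injective _ (E K))).2 hb0
      refine ⟨b, hb0, ?_⟩
      rw [← map_mul, mul_div_cancel₀ _ hb1]
      exact hD a
    · exact ⟨1, one_ne_zero, by rw [map_one, map_one, one_mul]; exact hx⟩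
  | zero => exact ⟨1, one_ne_zero, by rw [mul_zero]; exact zero_mem _⟩
  | one => exact ⟨1, one_ne_zero, by rw [mul_one]; exact hD 1⟩
  | add x y _ _ hx hy =>
    obtain ⟨a, ha, hax⟩ := hx
    obtain ⟨b, hb, hby⟩ := hy
    refine ⟨a * b, mul_ne_zero ha hb, ?_⟩
    have := add_mem (mul_mem (hD b) hax) (mul_mem (hD a) hby)
    rw [map_mul, map_mul]
    convert this using 1
    ring
  | neg x _ hx =>
    obtain ⟨a, ha, hax⟩ := hx
    exact ⟨a, ha, by rw [mul_neg]; exact neg_mem hax⟩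
  | mul x y _ _ hx hy =>
    obtain ⟨a, ha, hax⟩ := hx
    obtain ⟨b, hb, hby⟩ := hy
    refine ⟨a * b, mul_ne_zero ha hb, ?_⟩
    have := mul_mem hax hby
    rw [map_mul, map_mul]
    convert this using 1
    ring

theorem incl_mem_Q (j : ι) (e : E K) : incl K e ∈ Q c j :=
  (le_sup_left : (incl K).range ≤ Q c j) ⟨e, rfl⟩

theorem D_le_Q (j : ι) : D c {j}ᶜ ≤ Q c j := le_sup_right

theorem inv_mem_Q {j : ι} {x : Ehat K} (hx : x ∈ Q c j) : x⁻¹ ∈ Q c j := by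
  obtain ⟨b, hb, hbx⟩ := exists_mul_mem_D_of_mem_Q c hx
  suffices h : (incl K b * x)⁻¹ ∈ Q c j by
    have hb' : incl K b ≠ 0 := (_root_.map_ne_zero _).2 hb
    have : x⁻¹ = incl K b * (incl K b * x)⁻¹ := by rw [mul_inv, mul_inv_cancel_left₀ hb']
    rw [this]
    exact mul_mem (incl_mem_Q c j b) h
  -- Preparation needs some index `k ≠ j`. If there is none, `D_∅` already lies in the field `E`.
  rcases ({j}ᶜ : Set ι).eq_empty_or_nonempty with h | ⟨k, hk⟩
  · rw [h] at hbx
    obtain ⟨e, he⟩ := D_empty_le_range c hbx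
    rw [← he, ← map_inv₀]
    exact incl_mem_Q c j _
  · obtain ⟨p, -, u, hu⟩ := exists_weierstrass_preparation c hk hbx
    have huu : ((u : D c {j}ᶜ) : Ehat K) * ((u⁻¹ : (D c {j}ᶜ)ˣ) : D c {j}ᶜ) = 1 :=
      congrArg Subtype.val u.mul_inv
    rw [hu, mul_inv, ← map_inv₀, inv_eq_of_mul_eq_one_right huu]
    exact mul_mem (incl_mem_Q c j _) (D_le_Q c j (Subtype.property _))

theorem isField_Q (j : ι) : IsField (Q c j) where
  exists_pair_ne := ⟨0, 1, zero_ne_one⟩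
  mul_comm := mul_comm
  mul_inv_cancel {a} ha := ⟨⟨_, inv_mem_Q c a.2⟩,
    Subtype.ext (mul_inv_cancel₀ fun h => ha (Subtype.ext h))⟩

end

end AnalyticRings

end

theorem corollary1p12 {K : Type*} [Field K] [Infinite K] {ι : Type*} [Finite ι]
    (c : ι → K) (hc : Function.Injective c) (J : Set ι) (j : ι) (hj : j ∈ J) :
    (∀ g ∈ AnalyticRings.D c J, g ≠ 0 →
      (AnalyticRings.DInv c J j : Set (AnalyticRings.Ehat K)) =
        AnalyticRings.incl K '' (Algebra.adjoin (AnalyticRings.laurentField c j)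
            (AnalyticRings.z c '' J) : Set (AnalyticRings.E K)) +
          g • (AnalyticRings.DInv c J j : Set (AnalyticRings.Ehat K))) ∧
    (∀ f ∈ AnalyticRings.D c J,
      ∃ p ∈ Algebra.adjoin (AnalyticRings.powerSeriesRing c j) {AnalyticRings.z c j},
        ∃ u : (AnalyticRings.D c J)ˣ,
          f = AnalyticRings.incl K p * ((u : AnalyticRings.D c J) : AnalyticRings.Ehat K)) ∧
    IsField (AnalyticRings.Q c j) := by
  exact ⟨fun g hg hg0 => AnalyticRings.DInv_eq_add_smul c hj hg hg0,
    fun f hf => AnalyticRings.exists_weierstrass_preparation c hj hf, AnalyticRings.isField_Q c j⟩
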